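/- Let $G$ be a countable discrete group. For a map $\sigma:G\to\mathrm{Sym}(m)$ ($m\ge 1$, $\sigma$ not necessarily a homomorphism) and $F\subset G$, let $V(F)\subset\{1,\dots,m\}$ be the set of all $v$ such that $\sigma(f_1)\sigma(f_2)v=\sigma(f_1f_2)v$ for all $f_1,f_2\in F$ and $\sigma(f_1)v\neq\sigma(f_2)v$ for all distinct $f_1,f_2\in F$; $\sigma$ is an $(F,\epsilon)$-approximation to $G$ if $|V(F)|\ge(1-\epsilon)m$. The group $G$ is sofic if there are maps $\sigma_i:G\to\mathrm{Sym}(m_i)$, sets $F_1\subset F_2\subset\cdots$ with $\bigcup_i F_i=G$, and reals $\epsilon_i\to 0$ such that each $\sigma_i$ is an $(F_i,\epsilon_i)$-approximation to $G$. For a standard Borel probability space $(K,\kappa)$, the Bernoulli shift $(G,K^G,\kappa^G)$ is the action $(gx)(f)=x(g^{-1}f)$ of $G$ on $K^G$ with the product measure $\kappa^G$. The base entropy of $\kappa$ is $H(\kappa)=-\sum_{k\in K'}\kappa(\{k\})\log\kappa(\{k\})\in[0,+\infty]$ (with $0\log 0=0$) if there is a countable $K'\subset K$ with $\kappa(K')=1$,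 and $H(\kappa)=+\infty$ otherwise. Two probability-measure-preserving systems $(G_1,X_1,\mu_1)$, $(G_2,X_2,\mu_2)$ are conjugate up to automorphisms if there are a group isomorphism $\Phi:G_1\to G_2$, conull measurable sets $X_i'\subset X_i$ with $X_1'$ invariant under $G_1$, and a measure-space isomorphism $\phi:X_1'\to X_2'$ such that $\phi(gx)=\Phi(g)\phi(x)$ for all $g\in G_1$, $x\in X_1'$. If $G_1=G_2$ and $\Phi$ can be taken to be the identity, the systems are isomorphic. The group $G$ is Ornstein if, for any two standard Borel probability spaces $(K,\kappa)$, $(L,\lambda)$ with $H(\kappa)=H(\lambda)$, the systems $(G,K^G,\kappa^G)$ and $(G,L^G,\lambda^G)$ are isomorphic. Theorem. Let $G$ be a countable sofic Ornstein group and let $(K_1,\kappa_1)$, $(K_2,\kappa_2)$ be standard Borel probability spaces. Then $(G,K_1^G,\kappa_1^G)$ is conjugate up to automorphisms to $(G,K_2^G,\kappa_2^G)$ if and only if $H(\kappa_1)=H(\kappa_2)$ (where either entropy may be $+\infty$). -/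

import Mathlib

open MeasureTheory Filter Topology
open scoped ENNReal

namespace SoficBernoulli

/-! ### Sofic groups -/

/-- The set `V(F)` of points of `{1, …, m}` at which `σ` looks like a free action on `F`. -/
def goodPoints {G : Type*} [Group G] {m : ℕ} (σ : G → Equiv.Perm (Fin m)) (F : Set G) :
    Set (Fin m) :=
  {v | (∀ f₁ ∈ F, ∀ f₂ ∈ F, σ f₁ (σ f₂ v) = σ (f₁ * f₂) v) ∧
    ∀ f₁ ∈ F, ∀ f₂ ∈ F, f₁ ≠ f₂ → σ f₁ v ≠ σ f₂ v}

/-- `σ : G → Sym(m)` (an arbitrary map) is an `(F, ε)`-approximation to `G`. -/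
def IsApproximation {G : Type*} [Group G] {m : ℕ} (σ : G → Equiv.Perm (Fin m)) (F : Set G)
    (ε : ℝ) : Prop :=
  (1 - ε) * (m : ℝ) ≤ ((goodPoints σ F).ncard : ℝ)

/-- The sequence of maps `σ i : G → Sym(m i)` is a sofic approximation to `G`. -/
def IsSoficApproximation {G : Type*} [Group G] (m : ℕ → ℕ)
    (σ : (i : ℕ) → G → Equiv.Perm (Fin (m i))) : Prop :=
  (∀ i, 1 ≤ m i) ∧
  ∃ (F : ℕ → Set G) (ε : ℕ → ℝ),
    (∀ i, F i ⊆ F (i + 1)) ∧ (⋃ i, F i) = Set.univ ∧ Tendsto ε atTop (𝓝 0) ∧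
      ∀ i, IsApproximation (σ i) (F i) (ε i)

/-- `G` is sofic if it admits a sofic approximation. -/
def IsSofic (G : Type*) [Group G] : Prop :=
  ∃ (m : ℕ → ℕ) (σ : (i : ℕ) → G → Equiv.Perm (Fin (m i))), IsSoficApproximation m σ

/-! ### Conjugacy of systems -/

/-- A measure-space isomorphism between conull sets that intertwines the two actions along the
group isomorphism `Φ`. For `φ (g x)` to make sense the conull set `X₁'` has to be invariant. -/
def ConjugateAlong {G₁ G₂ X₁ X₂ : Type*} [Group G₁] [Group G₂] [MulAction G₁ X₁]
    [MulAction G₂ X₂] [MeasurableSpace X₁] [MeasurableSpace X₂] (Φ : G₁ ≃* G₂)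
    (μ₁ : Measure X₁) (μ₂ : Measure X₂) : Prop :=
  ∃ (X₁' : Set X₁) (X₂' : Set X₂) (φ : X₁' ≃ᵐ X₂'),
    MeasurableSet X₁' ∧ MeasurableSet X₂' ∧ μ₁ X₁'ᶜ = 0 ∧ μ₂ X₂'ᶜ = 0 ∧
    MeasurePreserving φ (μ₁.comap Subtype.val) (μ₂.comap Subtype.val) ∧
    ∀ (g : G₁) (x : X₁'), ∃ h : g • (x : X₁) ∈ X₁',
      ((φ ⟨g • (x : X₁), h⟩ : X₂') : X₂) = Φ g • ((φ x : X₂') : X₂)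

/-- Isomorphism (measure conjugacy) of two systems over the same group `G`. -/
def Isomorphic (G : Type*) {X₁ X₂ : Type*} [Group G] [MulAction G X₁] [MulAction G X₂]
    [MeasurableSpace X₁] [MeasurableSpace X₂] (μ₁ : Measure X₁) (μ₂ : Measure X₂) : Prop :=
  ConjugateAlong (MulEquiv.refl G) μ₁ μ₂

/-- The systems `(G₁, X₁, μ₁)` and `(G₂, X₂, μ₂)` are conjugate up to automorphisms. -/
def ConjugateUpToAutomorphisms (G₁ G₂ : Type*) {X₁ X₂ : Type*} [Group G₁] [Group G₂]
    [MulAction G₁ X₁] [MulAction G₂ X₂] [MeasurableSpace X₁] [MeasurableSpace X₂]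
    (μ₁ : Measure X₁) (μ₂ : Measure X₂) : Prop :=
  ∃ Φ : G₁ ≃* G₂, ConjugateAlong Φ μ₁ μ₂

/-! ### Bernoulli shifts -/

/-- The space `K^G` of all functions `G → K`. -/
def BernoulliSpace (G K : Type*) : Type _ := G → K

/-- The product Borel structure on `K^G`. -/
instance (G K : Type*) [MeasurableSpace K] : MeasurableSpace (BernoulliSpace G K) :=
  inferInstanceAs (MeasurableSpace (G → K))

/-- The shift action `(g x)(f) = x(g⁻¹ f)` of `G` on `K^G`. -/
instance (G K : Type*) [Group G] : MulAction G (BernoulliSpace G K) where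
  smul g x := fun f : G => x (g⁻¹ * f)
  one_smul x := funext fun f : G => congrArg x (by simp)
  mul_smul g h x := funext fun f : G => congrArg x (by simp [mul_assoc])

/-- The product measure `κ^G` on `K^G`. -/
noncomputable def bernoulliMeasure (G : Type*) {K : Type*} [MeasurableSpace K] (κ : Measure K) :
    Measure (BernoulliSpace G K) :=
  Measure.infinitePi (fun _ : G => κ)

open Classical in
/-- The entropy `H(κ)`: if `κ` is carried by a countable set it is `-∑ κ({k}) log κ({k})`
(a sum of nonnegative terms, possibly infinite; points outside a countable carrier have mass zero
and contribute nothing), and otherwise it is `+∞`. -/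
noncomputable def baseEntropy {K : Type*} [MeasurableSpace K] (κ : Measure K) : ℝ≥0∞ :=
  if ∃ K' : Set K, K'.Countable ∧ κ K' = 1 then
    ∑' k : K, ENNReal.ofReal (Real.negMulLog (κ.real {k}))
  else ⊤

/-- `G` is an Ornstein group: Bernoulli shifts over `G` whose base spaces are standard Borel
probability spaces of equal entropy are isomorphic. As every standard Borel space is Borel
isomorphic to a Borel subset of `ℝ`, quantifying over base spaces in `Type` loses nothing. -/
def IsOrnstein (G : Type*) [Group G] : Prop :=
  ∀ (K L : Type) [MeasurableSpace K] [MeasurableSpace L] [StandardBorelSpace K]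
    [StandardBorelSpace L] (κ : Measure K) (lam : Measure L) [IsProbabilityMeasure κ]
    [IsProbabilityMeasure lam],
    baseEntropy κ = baseEntropy lam →
      Isomorphic G (bernoulliMeasure G κ) (bernoulliMeasure G lam)

end SoficBernoulli

namespace SoficBernoulli

/-! ### Information functions and base entropy -/

/-! Equal entropies give an isomorphism by the Ornstein property. Conversely, a conjugacy and its
inverse reduce the claim to `IsSofic.baseEntropy_le`: if `φ : K^G → L^G` is equivariant and almost
surely invertible, then H(κ) ≤ H(λ).

Fix a finite partition `q` of `K`. By invertibility, `q (x 1)` is nearly a function `g` of finitely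
many bits of finitely many coordinates of `φ x`, and those bits are nearly a local function `f` of
`x`. Soficity moves `f` and `g` to `K^m`, where the labels `X v = q (x v)` are independent with
joint entropy `m * fiberEntropy κ q`. Gibbs' inequality bounds this entropy by the mean of `-log
Q(X, Y)` for any positive probability vector `Q`. Here `Y` is the field of `f`-values, and `Q` is a
product of weights `w` on the values of `Y` and of a channel `W` from decoded to true labels. The
logarithm is then a sum of local terms, and each has the mean of its counterpart on `K^G` at all but
few points (`IsSofic.fiberEntropy_le_integral`). Taking `w` near the law of the bits under λ and `W`
near the identity gives H(q) ≤ H(bits of λ) + η ≤ H(λ) + η. Only finite partitions enter, so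
infinite entropies need no separate treatment. -/

/-- The information content `-log p` of an event of probability `p`, with `-log 0 = ∞`. -/
noncomputable def infoContent (p : ℝ≥0∞) : ℝ≥0∞ := (-ENNReal.log p).toENNReal

lemma infoContent_antitone : Antitone infoContent := fun _ _ h =>
  EReal.toENNReal_le_toENNReal (EReal.neg_le_neg_iff.2 (ENNReal.log_monotone h))

lemma continuous_infoContent : Continuous infoContent :=
  EReal.continuous_toENNReal.comp (continuous_neg.comp ENNReal.continuous_log)

@[simp] lemma infoContent_zero : infoContent 0 = ⊤ := by simp [infoContent]

lemma infoContent_of_ne_zero {p : ℝ≥0∞} (h0 : p ≠ 0) (h1 : p ≠ ⊤) :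
    infoContent p = ENNReal.ofReal (-Real.log p.toReal) := by
  rw [infoContent, ENNReal.log_pos_real h0 h1, ← EReal.coe_neg,
    EReal.toENNReal_of_ne_top (EReal.coe_ne_top _), EReal.toReal_coe]

/-- Links means of information content to sums of `Real.negMulLog`. At `p = 0` the convention `⊤ * 0
= 0` plays the part of `0 log 0 = 0`. -/
lemma infoContent_mul_self {p : ℝ≥0∞} (h : p ≤ 1) :
    infoContent p * p = ENNReal.ofReal (Real.negMulLog p.toReal) := by
  have htop : p ≠ ⊤ := (h.trans_lt ENNReal.one_lt_top).ne
  rcases eq_or_ne p 0 with rfl | h0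
  · simp
  rw [infoContent_of_ne_zero h0 htop]
  conv_lhs => rw [← ENNReal.ofReal_toReal htop]
  rw [ENNReal.toReal_ofReal ENNReal.toReal_nonneg, ← ENNReal.ofReal_mul']
  · rw [Real.negMulLog]; ring_nf
  · exact ENNReal.toReal_nonneg

/-- The base entropy is the mean information content of a point. -/
lemma baseEntropy_eq_lintegral {K : Type*} [MeasurableSpace K] [MeasurableSingletonClass K]
    (κ : Measure K) [IsProbabilityMeasure κ] :
    baseEntropy κ = ∫⁻ x, infoContent (κ {x}) ∂κ := by
  unfold baseEntropy
  split_ifs with h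
  · obtain ⟨K', hc, h1⟩ := h
    have hz : κ K'ᶜ = 0 := (prob_compl_eq_zero_iff hc.measurableSet).2 h1
    rw [← setLIntegral_univ, ← Set.union_compl_self K',
      lintegral_union hc.measurableSet.compl disjoint_compl_right,
      setLIntegral_measure_zero _ _ hz, add_zero, lintegral_countable _ hc]
    rw [← tsum_subtype_eq_of_support_subset (s := K')]
    · exact tsum_congr fun k => (infoContent_mul_self prob_le_one).symm
    · intro k hk
      by_contra hk'
      refine hk ?_
      have : κ {k} = 0 := measure_mono_null (Set.singleton_subset_iff.2 hk') hz
      simp [measureReal_def, this]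
  -- There are only countably many atoms. Without a countable carrier the non-atoms have positive
  -- mass, and the information content is infinite on them.
  · set A : Set K := {x | κ {x} ≠ 0} with hA
    have hc : A.Countable := by
      have := Measure.countable_meas_pos_of_disjoint_iUnion (μ := κ) (As := fun x : K => {x})
        (fun x => measurableSet_singleton x) (fun x y hxy => by simpa using hxy)
      exact this.mono fun x hx => pos_iff_ne_zero.2 hx
    have hpos : κ Aᶜ ≠ 0 := fun hz => h ⟨A, hc, (prob_compl_eq_zero_iff hc.measurableSet).1 hz⟩
    symm
    rw [eq_top_iff]
    calc (⊤ : ℝ≥0∞) = ∫⁻ _ in Aᶜ, ⊤ ∂κ := by simp [hpos, ENNReal.top_mul]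
      _ ≤ ∫⁻ x in Aᶜ, infoContent (κ {x}) ∂κ := by
          refine setLIntegral_mono' hc.measurableSet.compl fun x hx => ?_
          have : κ {x} = 0 := by simpa [hA] using hx
          simp [this]
      _ ≤ _ := setLIntegral_le_lintegral _ _

/-- The Shannon entropy of the partition of `K` into the fibres of `q`. -/
noncomputable def fiberEntropy {K A : Type*} [MeasurableSpace K] [Fintype A] (κ : Measure K)
    (q : K → A) : ℝ :=
  ∑ a, Real.negMulLog (κ.real (q ⁻¹' {a}))

section FiberEntropy

variable {K A : Type*} [MeasurableSpace K] [Fintype A] [MeasurableSpace A]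
  [MeasurableSingletonClass A] (κ : Measure K) [IsProbabilityMeasure κ] {q : K → A}

/-- Writing the entropy as a mean over `K` allows partitions of different fineness to be compared
pointwise. -/
lemma ofReal_fiberEntropy (hq : Measurable q) :
    ENNReal.ofReal (fiberEntropy κ q) = ∫⁻ x, infoContent (κ (q ⁻¹' {q x})) ∂κ := by
  have h := lintegral_map (μ := κ) (f := fun a => infoContent (κ (q ⁻¹' {a})))
    (measurable_of_finite _) hq
  rw [← h, lintegral_fintype, fiberEntropy, ENNReal.ofReal_sum_of_nonneg]
  · refine Finset.sum_congr rfl fun a _ => ?_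
    rw [Measure.map_apply hq (measurableSet_singleton a), infoContent_mul_self prob_le_one]
    rfl
  · exact fun a _ => Real.negMulLog_nonneg measureReal_nonneg measureReal_le_one

/-- A fibre contains each of its points, so it carries no more information than the point. -/
lemma ofReal_fiberEntropy_le_baseEntropy [MeasurableSingletonClass K] (hq : Measurable q) :
    ENNReal.ofReal (fiberEntropy κ q) ≤ baseEntropy κ := by
  rw [ofReal_fiberEntropy κ hq, baseEntropy_eq_lintegral]
  exact lintegral_mono fun x => infoContent_antitone (measure_mono (by simp))

end FiberEntropy

/-- The first `n` bits of a code of the points of a countably generated space. -/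
noncomputable def bits (K : Type*) [MeasurableSpace K] [MeasurableSpace.CountablyGenerated K]
    (n : ℕ) (x : K) (i : Fin n) : Bool := MeasurableSpace.mapNatBool K x i

lemma measurable_bits (K : Type*) [MeasurableSpace K] [MeasurableSpace.CountablyGenerated K]
    (n : ℕ) : Measurable (bits K n) :=
  measurable_pi_lambda _ fun i =>
    (measurable_pi_apply (i : ℕ)).comp (MeasurableSpace.measurable_mapNatBool K)

/-- The base entropy is the supremum of the entropies of the partitions by finitely many bits. -/
lemma baseEntropy_le_of_fiberEntropy_bits_le {K : Type*} [MeasurableSpace K]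
    [StandardBorelSpace K] (κ : Measure K) [IsProbabilityMeasure κ] (C : ℝ≥0∞)
    (h : ∀ n, ENNReal.ofReal (fiberEntropy κ (bits K n)) ≤ C) : baseEntropy κ ≤ C := by
  have hlim (x : K) : Tendsto (fun n => infoContent (κ (bits K n ⁻¹' {bits K n x}))) atTop
      (𝓝 (infoContent (κ {x}))) := by
    refine (continuous_infoContent.tendsto _).comp ?_
    -- The bit code is injective, so its cylinders shrink to the point; bit `i` is first seen among
    -- the first `i + 1` bits.
    have hI : (⋂ n, bits K n ⁻¹' {bits K n x}) = {x} := by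
      ext y
      simp only [Set.mem_iInter, Set.mem_preimage, Set.mem_singleton_iff]
      refine ⟨fun hy => MeasurableSpace.injective_mapNatBool K (funext fun i => ?_),
        fun hy n => by rw [hy]⟩
      exact congrFun (hy (i + 1)) ⟨i, Nat.lt_succ_self i⟩
    rw [← hI]
    refine tendsto_measure_iInter_atTop
      (fun n => (measurable_bits K n (measurableSet_singleton _)).nullMeasurableSet) ?_
      ⟨0, measure_ne_top _ _⟩
    intro n m hnm y hy
    exact funext fun i => congrFun hy (Fin.castLE hnm i)
  -- Only one inequality is needed, so Fatou's lemma suffices.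
  rw [baseEntropy_eq_lintegral]
  calc ∫⁻ x, infoContent (κ {x}) ∂κ
      = ∫⁻ x, liminf (fun n => infoContent (κ (bits K n ⁻¹' {bits K n x}))) atTop ∂κ :=
        lintegral_congr fun x => (hlim x).liminf_eq.symm
    _ ≤ liminf (fun n => ∫⁻ x, infoContent (κ (bits K n ⁻¹' {bits K n x})) ∂κ) atTop :=
        lintegral_liminf_le fun n => (measurable_of_finite
          (fun a => infoContent (κ (bits K n ⁻¹' {a})))).comp (measurable_bits K n)
    _ ≤ C := by
        refine liminf_le_of_le (by isBoundedDefault) fun b hb => ?_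
        obtain ⟨n, hn⟩ := hb.exists
        exact hn.trans ((ofReal_fiberEntropy κ (measurable_bits K n)).symm.le.trans (h n))

/-- The base entropy is invariant under isomorphisms of measure spaces. -/
lemma baseEntropy_map_measurableEquiv {K L : Type*} [MeasurableSpace K] [MeasurableSpace L]
    [MeasurableSingletonClass K] [MeasurableSingletonClass L] (κ : Measure K)
    [IsProbabilityMeasure κ] (e : K ≃ᵐ L) : baseEntropy (κ.map e) = baseEntropy κ := by
  have := Measure.isProbabilityMeasure_map (μ := κ) e.measurable.aemeasurable
  rw [baseEntropy_eq_lintegral, baseEntropy_eq_lintegral, lintegral_map_equiv]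
  refine lintegral_congr fun x => ?_
  rw [e.map_apply]
  congr 2
  ext y
  simp

/-! ### Reindexing product measures -/

/-- Restricting a power of a probability measure along an injection of the index sets. -/
lemma measurePreserving_comp_injective {ι ι' K : Type*} [MeasurableSpace K] (κ : Measure K)
    [IsProbabilityMeasure κ] {j : ι → ι'} (hj : Function.Injective j) :
    MeasurePreserving (fun (x : ι' → K) i => x (j i)) (Measure.infinitePi fun _ => κ)
      (Measure.infinitePi fun _ => κ) := by
  have hm : Measurable (fun (x : ι' → K) i => x (j i)) := by fun_prop
  refine ⟨hm, Measure.eq_infinitePi _ fun s t ht => ?_⟩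
  classical
  rw [Measure.map_apply hm (MeasurableSet.pi s.countable_toSet fun i _ => ht i)]
  -- The preimage of a box is a box over `j(s)`; the value `Set.univ` off the range of `j` is never
  -- consulted.
  have hpre : (fun (x : ι' → K) i => x (j i)) ⁻¹' (Set.pi s t) =
      Set.pi (s.map ⟨j, hj⟩ : Finset ι') (Function.extend j t fun _ => Set.univ) := by
    ext x
    simp [Set.mem_pi, hj.extend_apply]
  rw [hpre, Measure.infinitePi_pi, Finset.prod_map]
  · simp [hj.extend_apply]
  · intro i hi
    obtain ⟨k, -, rfl⟩ := Finset.mem_map.1 hi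
    simpa [hj.extend_apply] using ht k

/-! ### Gibbs' inequality -/

/-- Expand the product of the sums. This normalises the memoryless weights and channels used in
Gibbs' inequality. -/
lemma sum_prod_eq_one {V A : Type*} [Fintype V] [DecidableEq V] [Fintype A] (r : V → A → ℝ)
    (hr : ∀ v, ∑ a, r v a = 1) : ∑ x : V → A, ∏ v, r v (x v) = 1 := by
  rw [← Fintype.piFinset_univ, ← Finset.prod_univ_sum]
  simp [hr]

section Gibbs

variable {Ω A B : Type*} [MeasurableSpace Ω] (μ : Measure Ω) [IsProbabilityMeasure μ]
  [Fintype A] [MeasurableSpace A] [MeasurableSingletonClass A]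
  [Fintype B] [MeasurableSpace B] [MeasurableSingletonClass B]

lemma integral_comp_eq_sum {X : Ω → A} (hX : Measurable X) (F : A → ℝ) :
    ∫ ω, F (X ω) ∂μ = ∑ a, μ.real (X ⁻¹' {a}) * F a := by
  have := Measure.isProbabilityMeasure_map (μ := μ) hX.aemeasurable
  rw [← integral_map hX.aemeasurable (f := F)
    (measurable_of_finite F).aestronglyMeasurable, integral_fintype .of_finite]
  refine Finset.sum_congr rfl fun a _ => ?_
  rw [map_measureReal_apply hX (measurableSet_singleton a), smul_eq_mul]

lemma integrable_comp_finite {X : Ω → A} (hX : Measurable X) (F : A → ℝ) :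
    Integrable (fun ω => F (X ω)) μ := by
  have := Measure.isProbabilityMeasure_map (μ := μ) hX.aemeasurable
  exact (Integrable.of_finite (f := F) (μ := μ.map X)).comp_measurable hX

/-- Gibbs' inequality: the entropy of `X` is at most the cross entropy of `(X, Y)` relative to a
positive subprobability vector. -/
lemma fiberEntropy_le_integral_neg_log {X : Ω → A} {Y : Ω → B} (hX : Measurable X)
    (hY : Measurable Y) (Q : A × B → ℝ) (hQ : ∀ p, 0 < Q p) (hQ1 : ∑ p, Q p ≤ 1) :
    fiberEntropy μ X ≤ ∫ ω, -Real.log (Q (X ω, Y ω)) ∂μ := by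
  have hXY : Measurable fun ω => (X ω, Y ω) := hX.prodMk hY
  set P : A → ℝ := fun a => μ.real (X ⁻¹' {a}) with hP
  set p : A × B → ℝ := fun c => μ.real ((fun ω => (X ω, Y ω)) ⁻¹' {c}) with hp
  have hp0 (c) : 0 ≤ p c := measureReal_nonneg
  have hp1 : ∑ c, p c = 1 := by
    have := integral_comp_eq_sum μ hXY fun _ => (1 : ℝ)
    simpa using this.symm
  -- This domination of the joint law by the marginal is what lets `Y` be discarded: it encodes H(X)
  -- ≤ H(X, Y).
  have hpP (c : A × B) : p c ≤ P c.1 := by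
    refine measureReal_mono fun ω hω => ?_
    have : (X ω, Y ω) = c := hω
    simp [← this]
  have hH : fiberEntropy μ X = ∑ c, p c * -Real.log (P c.1) := by
    rw [← integral_comp_eq_sum μ hXY fun c => -Real.log (P c.1),
      integral_comp_eq_sum μ hX fun a => -Real.log (P a), fiberEntropy]
    refine Finset.sum_congr rfl fun a _ => ?_
    simp [Real.negMulLog, hP]
  rw [hH, integral_comp_eq_sum μ hXY fun c => -Real.log (Q c), ← sub_nonpos,
    ← Finset.sum_sub_distrib]
  calc ∑ c, (p c * -Real.log (P c.1) - p c * -Real.log (Q c))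
      ≤ ∑ c, (Q c - p c) := by
        refine Finset.sum_le_sum fun c _ => ?_
        rcases (hp0 c).eq_or_lt with h | h
        · simp [← h, (hQ c).le]
        have hPc : 0 < P c.1 := h.trans_le (hpP c)
        have hlog : Real.log (Q c) - Real.log (P c.1) ≤ Q c / P c.1 - 1 := by
          rw [← Real.log_div (hQ c).ne' hPc.ne']
          exact Real.log_le_sub_one_of_pos (div_pos (hQ c) hPc)
        have hle : p c * (Q c / P c.1) ≤ Q c := by
          rw [mul_div_assoc', div_le_iff₀ hPc, mul_comm]
          exact mul_le_mul_of_nonneg_left (hpP c) (hQ c).le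
        nlinarith [mul_le_mul_of_nonneg_left hlog h.le]
    _ ≤ 0 := by rw [Finset.sum_sub_distrib, hp1]; linarith

/-- The entropy of a finite family of random variables that is decoded with a memoryless channel
`W` from a second family with memoryless weights `w`. -/
lemma fiberEntropy_le_sum_integral {V : Type*} [Fintype V] [DecidableEq V] {X : Ω → V → A} {Y : Ω → V → B}
    (hX : Measurable X) (hY : Measurable Y) (D : V → (V → B) → A)
    (w : B → ℝ) (hw : ∀ b, 0 < w b) (hw1 : ∑ b, w b = 1)
    (W : A → A → ℝ) (hW : ∀ a c, 0 < W a c) (hW1 : ∀ c, ∑ a, W a c = 1) :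
    fiberEntropy μ X ≤
      ∑ v, ∫ ω, (-Real.log (w (Y ω v)) - Real.log (W (X ω v) (D v (Y ω)))) ∂μ := by
  have hXY : Measurable fun ω => (X ω, Y ω) := hX.prodMk hY
  -- For fixed `y` the channel factors sum to one over `x`, and then the weights sum to one over
  -- `y`. The variables `Y v` need not be independent: `Q` is only a reference vector.
  have h := fiberEntropy_le_integral_neg_log μ hX hY
    (fun p => (∏ v, w (p.2 v)) * ∏ v, W (p.1 v) (D v p.2))
    (fun p => mul_pos (Finset.prod_pos fun v _ => hw _) (Finset.prod_pos fun v _ => hW _ _)) (by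
      rw [Fintype.sum_prod_type_right]
      simp_rw [← Finset.mul_sum]
      refine le_of_eq ?_
      calc _ = ∑ y : V → B, (∏ v, w (y v)) * 1 := by
            refine Finset.sum_congr rfl fun y _ => ?_
            rw [sum_prod_eq_one (fun v a => W a (D v y)) fun v => hW1 _]
        _ = 1 := by simp_rw [mul_one]; exact sum_prod_eq_one (fun _ => w) fun _ => hw1)
  refine h.trans_eq ?_
  rw [← integral_finsetSum _ fun v _ => integrable_comp_finite μ hXY
    fun p => -Real.log (w (p.2 v)) - Real.log (W (p.1 v) (D v p.2))]
  refine integral_congr_ae (.of_forall fun ω => ?_)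
  simp only
  rw [Real.log_mul (Finset.prod_pos fun v _ => hw _).ne'
    (Finset.prod_pos fun v _ => hW _ _).ne', Real.log_prod fun v _ => (hw _).ne',
    Real.log_prod fun v _ => (hW _ _).ne', Finset.sum_sub_distrib, Finset.sum_neg_distrib]
  ring

/-- The entropy of a finite independent family of identically distributed random variables. -/
lemma fiberEntropy_infinitePi {K : Type*} [MeasurableSpace K] (κ : Measure K)
    [IsProbabilityMeasure κ] {q : K → A} (hq : Measurable q) {V : Type*} [Fintype V] [DecidableEq V] :
    fiberEntropy (Measure.infinitePi fun _ : V => κ) (fun x v => q (x v)) =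
      Fintype.card V * fiberEntropy κ q := by
  set μ := Measure.infinitePi fun _ : V => κ
  set p : A → ℝ := fun a => κ.real (q ⁻¹' {a}) with hp
  have hX : Measurable fun (x : V → K) v => q (x v) := by fun_prop
  have hP (a : V → A) : μ.real ((fun (x : V → K) v => q (x v)) ⁻¹' {a}) = ∏ v, p (a v) := by
    have : (fun (x : V → K) v => q (x v)) ⁻¹' {a} =
        Set.pi (Finset.univ : Finset V) fun v => q ⁻¹' {a v} := by
      ext x; simp [funext_iff]
    rw [this, measureReal_def, Measure.infinitePi_pi, ENNReal.toReal_prod]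
    · rfl
    · exact fun v _ => hq (measurableSet_singleton _)
  calc fiberEntropy μ (fun x v => q (x v))
      = ∑ a : V → A, (∏ v, p (a v)) * ∑ v, -Real.log (p (a v)) := by
        refine Finset.sum_congr rfl fun a _ => ?_
        rw [hP, Real.negMulLog]
        -- The logarithm of a product splits only when no factor vanishes; otherwise both sides are
        -- zero.
        by_cases h : ∏ v, p (a v) = 0
        · simp [h]
        · rw [Real.log_prod fun v hv => Finset.prod_ne_zero_iff.1 h v hv, Finset.sum_neg_distrib]
          ring
    _ = ∫ x, ∑ v, -Real.log (p (q (x v))) ∂μ := by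
        rw [integral_comp_eq_sum μ hX fun a => ∑ v, -Real.log (p (a v))]
        simp_rw [hP]
    _ = ∑ v : V, fiberEntropy κ q := by
        have hm (v : V) : Measurable fun x : V → K => q (x v) := by fun_prop
        rw [integral_finsetSum _ fun v _ => integrable_comp_finite μ (hm v)
          fun a => -Real.log (p a)]
        refine Finset.sum_congr rfl fun v _ => ?_
        rw [integral_comp_eq_sum μ (hm v) fun a => -Real.log (p a)]
        refine Finset.sum_congr rfl fun a _ => ?_
        have : μ.real ((fun x : V → K => q (x v)) ⁻¹' {a}) = p a := by
          rw [← Function.comp_def q, Set.preimage_comp, measureReal_def,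
            (measurePreserving_eval_infinitePi (fun _ : V => κ) v).measure_preimage
              (hq (measurableSet_singleton a)).nullMeasurableSet]
          rfl
        rw [this, Real.negMulLog]
        ring
    _ = _ := by simp

end Gibbs

/-! ### Transfer to sofic approximations -/

lemma goodPoints_anti {G : Type*} [Group G] {m : ℕ} (σ : G → Equiv.Perm (Fin m)) {S T : Set G}
    (h : S ⊆ T) : goodPoints σ T ⊆ goodPoints σ S := fun _ hv =>
  ⟨fun a ha b hb => hv.1 a (h ha) b (h hb), fun a ha b hb => hv.2 a (h ha) b (h hb)⟩

/-- A sofic group has arbitrarily good approximations on finite sets. -/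
lemma IsSofic.exists_approximation {G : Type*} [Group G] (hG : IsSofic G) (S : Finset G)
    {δ : ℝ} (hδ : 0 < δ) :
    ∃ m : ℕ, 0 < m ∧ ∃ σ : G → Equiv.Perm (Fin m), IsApproximation σ (S : Set G) δ := by
  obtain ⟨m, σ, hm, F, ε, hF, hU, hε, happ⟩ := hG
  have hmono : Monotone F := monotone_nat_of_le_succ hF
  have hS : ∀ᶠ i in atTop, (S : Set G) ⊆ F i := by
    have : ∀ᶠ i in atTop, ∀ g ∈ S, g ∈ F i := by
      rw [eventually_all_finset]
      intro g _
      obtain ⟨i, hi⟩ := Set.mem_iUnion.1 (hU.symm ▸ Set.mem_univ g)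
      filter_upwards [eventually_ge_atTop i] with k hk using hmono hk hi
    exact this.mono fun i h g hg => h g hg
  obtain ⟨i, hi, hεi⟩ := (hS.and (hε.eventually_lt_const hδ)).exists
  refine ⟨m i, hm i, σ i, ?_⟩
  have h1 := happ i
  unfold IsApproximation at h1 ⊢
  calc (1 - δ) * (m i : ℝ) ≤ (1 - ε i) * (m i : ℝ) := by gcongr
    _ ≤ _ := h1
    _ ≤ _ := by exact_mod_cast Set.ncard_le_ncard (goodPoints_anti _ hi) (Set.toFinite _)

section Transfer

variable {G K A B : Type*} [Group G] [MeasurableSpace K] (κ : Measure K) [IsProbabilityMeasure κ]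
  [Fintype A] [MeasurableSpace A] [MeasurableSingletonClass A]
  [Fintype B] [MeasurableSpace B] [MeasurableSingletonClass B]
  (E F : Finset G) (f : (F → K) → B) (g : (E → B) → A) (q : K → A)

/-- Means of local observables at a good point agree with those of the Bernoulli shift. -/
lemma integral_local_eq {m : ℕ} {σ : G → Equiv.Perm (Fin m)} {S : Set G} {v : Fin m}
    (hv : v ∈ goodPoints σ S) (h1 : (1 : G) ∈ S) (hE : ∀ s ∈ E, s⁻¹ ∈ S) (hF : ∀ t ∈ F, t⁻¹ ∈ S)
    (hEF : ∀ s ∈ E, ∀ t ∈ F, (s * t)⁻¹ ∈ S)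
    (hf : Measurable f) (hq : Measurable q) (Ψ : B × A × A → ℝ) :
    ∫ x, Ψ (f fun t : F => x (σ (t : G)⁻¹ v), q (x v),
        g fun s : E => f fun t : F => x (σ (t : G)⁻¹ (σ (s : G)⁻¹ v)))
        ∂(Measure.infinitePi fun _ : Fin m => κ) =
      ∫ x, Ψ (f fun t : F => x t, q (x 1), g fun s : E => f fun t : F => x (s * t))
        ∂(Measure.infinitePi fun _ : G => κ) := by
  -- The site playing the role of `h` around `v` is `σ h⁻¹ v`; the inverse makes nested sites
  -- compose to `σ (s * t)⁻¹ v`. At a good point this labelling is injective on `T`, so both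
  -- patterns indexed by `T` have law `κ^T`.
  let T : Set G := S⁻¹
  have hT1 : (1 : G) ∈ T := by simpa [T] using h1
  have hTF (t : F) : (t : G) ∈ T := hF t t.2
  have hTEF (s : E) (t : F) : (s * t : G) ∈ T := hEF s s.2 t t.2
  let D : (T → K) → ℝ := fun r => Ψ (f fun t : F => r ⟨t, hTF t⟩, q (r ⟨1, hT1⟩),
    g fun s : E => f fun t : F => r ⟨s * t, hTEF s t⟩)
  have hD : Measurable D := by
    refine (measurable_of_finite Ψ).comp (Measurable.prodMk ?_ (Measurable.prodMk ?_ ?_))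
    · exact hf.comp (by fun_prop)
    · exact hq.comp (by fun_prop)
    · refine (measurable_of_finite g).comp (measurable_pi_lambda _ fun s => hf.comp (by fun_prop))
  have hjV : Function.Injective fun h : T => σ (h : G)⁻¹ v := by
    intro a b hab
    by_contra hne
    exact hv.2 _ a.2 _ b.2 (fun h => hne (Subtype.ext (inv_injective h))) hab
  have hV := (measurePreserving_comp_injective κ hjV)
  have hG := (measurePreserving_comp_injective κ (Subtype.val_injective (p := (· ∈ T))))
  -- `σ` need not be a homomorphism, but `σ 1 (σ 1 v) = σ 1 v` holds at a good point and `σ 1`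
  -- cancels.
  have hσ1 : σ 1 v = v := by
    have := hv.1 1 h1 1 h1
    rw [mul_one] at this
    exact (σ 1).injective this
  have e1 : ∀ x : Fin m → K, D (fun h : T => x (σ (h : G)⁻¹ v)) =
      Ψ (f fun t : F => x (σ (t : G)⁻¹ v), q (x v),
        g fun s : E => f fun t : F => x (σ (t : G)⁻¹ (σ (s : G)⁻¹ v))) := by
    intro x
    have : ∀ (s : E) (t : F), σ (t : G)⁻¹ (σ (s : G)⁻¹ v) = σ (s * t : G)⁻¹ v := by
      intro s t
      rw [hv.1 _ (hF t t.2) _ (hE s s.2), mul_inv_rev]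
    simp only [D, this, inv_one, hσ1]
  simp_rw [← e1]
  rw [← integral_map hV.measurable.aemeasurable (f := D) hD.aestronglyMeasurable, hV.map_eq,
    ← hG.map_eq, integral_map hG.measurable.aemeasurable hD.aestronglyMeasurable]

/-- Over a sofic group, the entropy of a base partition is bounded by the cross entropy of a local
observable plus the cross entropy of its local decoding. -/
theorem IsSofic.fiberEntropy_le_integral (hG : IsSofic G) (hf : Measurable f) (hq : Measurable q)
    (w : B → ℝ) (hw : ∀ b, 0 < w b) (hw1 : ∑ b, w b = 1)
    (W : A → A → ℝ) (hW : ∀ a c, 0 < W a c) (hW1 : ∀ c, ∑ a, W a c = 1) :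
    fiberEntropy κ q ≤ ∫ x, (-Real.log (w (f fun t : F => x t)) -
      Real.log (W (q (x 1)) (g fun s : E => f fun t : F => x (s * t))))
        ∂(Measure.infinitePi fun _ : G => κ) := by
  classical
  set Ψ : B × A × A → ℝ := fun p => -Real.log (w p.1) - Real.log (W p.2.1 p.2.2) with hΨ
  have hΨ0 (p) : 0 ≤ Ψ p := by
    have h1 : w p.1 ≤ 1 := hw1 ▸ Finset.single_le_sum (fun b _ => (hw b).le) (Finset.mem_univ _)
    have h2 : W p.2.1 p.2.2 ≤ 1 := hW1 p.2.2 ▸ Finset.single_le_sum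
      (f := fun a => W a p.2.2) (fun b _ => (hW b _).le) (Finset.mem_univ p.2.1)
    have h3 := Real.log_nonpos (hw _).le h1
    have h4 := Real.log_nonpos (hW _ _).le h2
    simp only [hΨ]
    linarith
  -- A crude uniform bound on the integrand: the price of a bad point.
  set C : ℝ := ∑ p, Ψ p
  have hΨC (p) : Ψ p ≤ C := Finset.single_le_sum (fun p _ => hΨ0 p) (Finset.mem_univ p)
  have hC0 : 0 ≤ C := Finset.sum_nonneg fun p _ => hΨ0 p
  set I : ℝ := ∫ x, Ψ (f fun t : F => x t, q (x 1), g fun s : E => f fun t : F => x (s * t))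
        ∂(Measure.infinitePi fun _ : G => κ)
  have hI0 : 0 ≤ I := integral_nonneg fun x => hΨ0 _
  change fiberEntropy κ q ≤ I
  let S : Finset G := {1} ∪ E.image (·⁻¹) ∪ F.image (·⁻¹) ∪
    (E ×ˢ F).image fun p => (p.1 * p.2)⁻¹
  -- Average over the `m` sites: good ones contribute at most `I`, and at most `δ * m` bad ones
  -- contribute at most `C` each.
  have key (δ : ℝ) (hδ : 0 < δ) : fiberEntropy κ q ≤ I + δ * C := by
    obtain ⟨m, hm, σ, hσ⟩ := hG.exists_approximation S hδ
    have hm' : (0 : ℝ) < m := by exact_mod_cast hm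
    set μ := Measure.infinitePi fun _ : Fin m => κ
    have h := fiberEntropy_le_sum_integral μ (X := fun x v => q (x v))
      (Y := fun x v => f fun t : F => x (σ (t : G)⁻¹ v)) (by fun_prop)
      (measurable_pi_lambda _ fun v => hf.comp (by fun_prop))
      (fun v y => g fun s : E => y (σ (s : G)⁻¹ v)) w hw hw1 W hW hW1
    rw [fiberEntropy_infinitePi κ hq, Fintype.card_fin] at h
    have hgood (v) (hv : v ∈ goodPoints σ (S : Set G)) :=
      integral_local_eq κ E F f g q hv (by simp [S])
        (fun s hs => by simp [S, hs]) (fun t ht => by simp [S, ht])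
        (fun s hs t ht => by
          simp only [S, Finset.mem_coe, Finset.mem_union]
          exact Or.inr (Finset.mem_image_of_mem (fun p : G × G => (p.1 * p.2)⁻¹)
            (Finset.mk_mem_product hs ht))) hf hq Ψ
    have hbad (v : Fin m) : ∫ x, Ψ (f fun t : F => x (σ (t : G)⁻¹ v), q (x v),
        g fun s : E => f fun t : F => x (σ (t : G)⁻¹ (σ (s : G)⁻¹ v))) ∂μ ≤ C := by
      calc _ ≤ ∫ _, C ∂μ := integral_mono_of_nonneg (.of_forall fun x => hΨ0 _)
            (integrable_const _) (.of_forall fun x => hΨC _)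
        _ = C := by simp
    have hsum : (m : ℝ) * fiberEntropy κ q ≤
        ∑ v : Fin m, (I + if v ∈ goodPoints σ (S : Set G) then 0 else C) := by
      refine h.trans (Finset.sum_le_sum fun v _ => ?_)
      split_ifs with hv
      · rw [add_zero]; exact (hgood v hv).le
      · exact (hbad v).trans (by linarith)
    have hcount : ∑ v : Fin m, (if v ∈ goodPoints σ (S : Set G) then 0 else C) ≤ m * δ * C := by
      have h2 : ∑ v : Fin m, (if v ∈ goodPoints σ (S : Set G) then 0 else C) =
          (m - (goodPoints σ (S : Set G)).ncard) * C := by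
        have : ∀ v : Fin m, (if v ∈ goodPoints σ (S : Set G) then 0 else C) =
            C - if v ∈ goodPoints σ (S : Set G) then C else 0 := by
          intro v; split_ifs <;> simp
        simp_rw [this]
        rw [Finset.sum_sub_distrib, ← Finset.sum_filter, Finset.sum_const, Finset.sum_const,
          Set.ncard_eq_toFinset_card']
        simp [sub_mul, Set.toFinset]
      rw [h2]
      refine mul_le_mul_of_nonneg_right ?_ hC0
      unfold IsApproximation at hσ
      linarith
    rw [Finset.sum_add_distrib, Finset.sum_const, Finset.card_univ, Fintype.card_fin,
      nsmul_eq_mul] at hsum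
    have : (m : ℝ) * fiberEntropy κ q ≤ m * (I + δ * C) := by linarith
    exact le_of_mul_le_mul_left this hm'
  refine le_of_forall_pos_le_add fun ε hε => ?_
  refine (key (ε / (C + 1)) (by positivity)).trans ?_
  gcongr
  rw [div_mul_eq_mul_div, div_le_iff₀ (by positivity)]
  nlinarith

end Transfer

/-! ### Approximation by local observables -/

/-- A finite-valued observable on a product space is approximated by observables that depend on
finitely many coordinates. -/
lemma exists_local_approx {ι X B : Type*} [MeasurableSpace X] (μ : Measure (ι → X))
    [IsFiniteMeasure μ] [Fintype B] [Nonempty B] [MeasurableSpace B] [MeasurableSingletonClass B]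
    {h : (ι → X) → B} (hh : Measurable h) {ε : ℝ} (hε : 0 < ε) :
    ∃ (F : Finset ι) (f : (F → X) → B), Measurable f ∧
      μ.real {x | h x ≠ f fun i : F => x i} ≤ ε := by
  classical
  have happ (b : B) : ∃ T ∈ measurableCylinders fun _ : ι => X,
      μ (symmDiff T (h ⁻¹' {b})) < ENNReal.ofReal (ε / Fintype.card B) :=
    exists_measure_symmDiff_lt_of_generateFrom_isSetRing isSetRing_measurableCylinders
      ⟨{Set.univ}, Set.countable_singleton _, by simpa using univ_mem_measurableCylinders fun _ : ι => X,
        by simp⟩ generateFrom_measurableCylinders.symm (hh (measurableSet_singleton b))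
      (ENNReal.ofReal_pos.2 (div_pos hε (by exact_mod_cast Fintype.card_pos)))
  choose T hT hTμ using happ
  have hT' (b : B) := (mem_measurableCylinders _).1 (hT b)
  choose s S hS hTS using hT'
  let F : Finset ι := Finset.univ.biUnion s
  have hF (b : B) : s b ⊆ F := Finset.subset_biUnion_of_mem s (Finset.mem_univ b)
  -- The approximating cylinders need not partition the space, so some label whose cylinder contains
  -- the point is chosen. Outside all symmetric differences the only such label is the true one.
  let dec : (B → Prop) → B := fun P => if h : ∃ b, P b then h.choose else Classical.arbitrary B
  let f : (F → X) → B := fun r => dec fun b => (fun i : s b => r ⟨i, hF b i.2⟩) ∈ S b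
  refine ⟨F, f, (measurable_of_finite dec).comp (measurable_pi_lambda _ fun b =>
    (measurable_mem.2 (hS b)).comp (by fun_prop)), ?_⟩
  have hsub : {x | h x ≠ f fun i : F => x i} ⊆
      ⋃ b ∈ (Finset.univ : Finset B), symmDiff (T b) (h ⁻¹' {b}) := by
    intro x hx
    by_contra hx'
    simp only [Finset.mem_univ, Set.iUnion_true, Set.mem_iUnion, not_exists] at hx'
    have hiff (b : B) : (fun i : s b => x i) ∈ S b ↔ h x = b := by
      have h1 : x ∈ T b ↔ (fun i : s b => x i) ∈ S b := by
        rw [hTS b, mem_cylinder]; rfl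
      have h2 := hx' b
      rw [Set.mem_symmDiff] at h2
      rw [← h1]
      change _ ↔ x ∈ h ⁻¹' {b}
      tauto
    refine hx ?_
    have hex : ∃ b, (fun i : s b => x i) ∈ S b := ⟨h x, (hiff _).2 rfl⟩
    change h x = dec fun b => (fun i : s b => x i) ∈ S b
    simp only [dec]
    rw [dif_pos hex]
    exact (hiff _).1 hex.choose_spec
  calc μ.real {x | h x ≠ f fun i : F => x i}
      ≤ μ.real (⋃ b ∈ (Finset.univ : Finset B), symmDiff (T b) (h ⁻¹' {b})) :=
        measureReal_mono hsub (measure_ne_top _ _)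
    _ ≤ ∑ b, μ.real (symmDiff (T b) (h ⁻¹' {b})) := measureReal_biUnion_finset_le _ _
    _ ≤ ∑ _b : B, ε / Fintype.card B := Finset.sum_le_sum fun b _ =>
        ENNReal.toReal_le_of_le_ofReal (by positivity) (hTμ b).le
    _ = ε := by
        rw [Finset.sum_const, Finset.card_univ, nsmul_eq_mul]
        field_simp

/-- A finite-valued observable on a countable power of a standard Borel space is approximated by
observables that depend on finitely many bits of finitely many coordinates. -/
lemma exists_bits_approx {ι L A : Type*} [Countable ι] [MeasurableSpace L] [StandardBorelSpace L]
    (μ : Measure (ι → L)) [IsFiniteMeasure μ] [Fintype A] [Nonempty A] [MeasurableSpace A]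
    [MeasurableSingletonClass A] {h : (ι → L) → A} (hh : Measurable h) {ε : ℝ} (hε : 0 < ε) :
    ∃ (N : ℕ) (E : Finset ι) (g : (E → Fin N → Bool) → A),
      μ.real {y | h y ≠ g fun s : E => bits L N (y s)} ≤ ε := by
  classical
  -- Coding all coordinates by bits embeds the power measurably in a space of bit arrays. A local
  -- observable there reads finitely many pairs (coordinate, bit).
  let c : (ι → L) → (ι × ℕ → Bool) := fun y p => MeasurableSpace.mapNatBool L (y p.1) p.2
  have hc : Measurable c := measurable_pi_lambda _ fun p =>
    (measurable_pi_apply p.2).comp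
      ((MeasurableSpace.measurable_mapNatBool L).comp (measurable_pi_apply p.1))
  have hinj : Function.Injective c := fun y z hyz => funext fun i =>
    MeasurableSpace.injective_mapNatBool L (funext fun n => congrFun hyz (i, n))
  obtain ⟨h', hh', hcomp⟩ := (hc.measurableEmbedding hinj).exists_measurable_extend hh
    fun _ => inferInstance
  obtain ⟨F, f, hf, hle⟩ := exists_local_approx (μ.map c) hh' hε
  let N := F.sup Prod.snd + 1
  have hN (p : F) : (p : ι × ℕ).2 < N := Nat.lt_succ_of_le (Finset.le_sup (f := Prod.snd) p.2)
  let E := F.image Prod.fst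
  refine ⟨N, E, fun u => f fun p : F =>
    u ⟨(p : ι × ℕ).1, Finset.mem_image_of_mem _ p.2⟩ ⟨(p : ι × ℕ).2, hN p⟩, ?_⟩
  have hmeas : MeasurableSet {x | h' x ≠ f fun i : F => x i} :=
    (measurableSet_eq_fun hh' (hf.comp (by fun_prop))).compl
  rw [map_measureReal_apply hc hmeas] at hle
  refine le_trans (measureReal_mono fun y hy => ?_) hle
  change h y ≠ _ at hy
  rwa [← congrFun hcomp y] at hy

/-! ### Monotonicity of the base entropy -/

/-- A perturbation of a probability vector that is bounded below costs little cross entropy. -/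
lemma integral_neg_log_mix_le {L B : Type*} [MeasurableSpace L] (ν : Measure L)
    [IsProbabilityMeasure ν] [Fintype B] [MeasurableSpace B] [MeasurableSingletonClass B]
    {q : L → B} (hq : Measurable q) {t u : ℝ} (ht0 : 0 < t) (ht1 : t < 1) (hu : 0 < u) :
    ∫ y, -Real.log ((1 - t) * ν.real (q ⁻¹' {q y}) + u) ∂ν ≤
      fiberEntropy ν q - Real.log (1 - t) := by
  have h1 : ∑ b, ν.real (q ⁻¹' {b}) = 1 := by
    have := integral_comp_eq_sum ν hq fun _ => (1 : ℝ)
    simpa using this.symm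
  rw [integral_comp_eq_sum ν hq fun b => -Real.log ((1 - t) * ν.real (q ⁻¹' {b}) + u)]
  calc ∑ b, ν.real (q ⁻¹' {b}) * -Real.log ((1 - t) * ν.real (q ⁻¹' {b}) + u)
      ≤ ∑ b, (Real.negMulLog (ν.real (q ⁻¹' {b})) + ν.real (q ⁻¹' {b}) * -Real.log (1 - t)) := by
        refine Finset.sum_le_sum fun b _ => ?_
        rcases (measureReal_nonneg (μ := ν) (s := q ⁻¹' {b})).eq_or_lt with h | h
        · simp [← h]
        -- Dropping `u > 0` only increases the negative logarithm; fibres of mass zero were dealt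
        -- with above.
        have hlog : Real.log (1 - t) + Real.log (ν.real (q ⁻¹' {b})) ≤
            Real.log ((1 - t) * ν.real (q ⁻¹' {b}) + u) := by
          rw [← Real.log_mul (by linarith) h.ne']
          exact Real.log_le_log (mul_pos (by linarith) h) (by linarith)
        rw [Real.negMulLog]
        nlinarith
    _ = fiberEntropy ν q - Real.log (1 - t) := by
        rw [Finset.sum_add_distrib, ← Finset.sum_mul, h1, fiberEntropy]
        ring

section Monotone

variable {G K L : Type*} [Group G] [Countable G]
  [MeasurableSpace K] [MeasurableSpace L] [StandardBorelSpace L]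
  (κ : Measure K) [IsProbabilityMeasure κ] (lam : Measure L) [IsProbabilityMeasure lam]
  {φ : (G → K) → (G → L)} {ψ : (G → L) → (G → K)}

/-- The images of a local partition and its decoding are simultaneously approximated by local
observables. -/
lemma exists_local_factor
    (hφ : MeasurePreserving φ (Measure.infinitePi fun _ => κ) (Measure.infinitePi fun _ => lam))
    (hequiv : ∀ s : G, ∀ᵐ x ∂(Measure.infinitePi fun _ : G => κ),
      φ (fun h => x (s * h)) = fun h => φ x (s * h))
    (hψ : Measurable ψ) (hinv : ∀ᵐ x ∂(Measure.infinitePi fun _ : G => κ), ψ (φ x) = x)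
    {A : Type*} [Fintype A] [MeasurableSpace A] [MeasurableSingletonClass A] {q : K → A}
    (hq : Measurable q) {δ : ℝ} (hδ : 0 < δ) :
    ∃ (N : ℕ) (E : Finset G) (g : (E → Fin N → Bool) → A), ∀ δ' : ℝ, 0 < δ' →
      ∃ (F : Finset G) (f : (F → K) → Fin N → Bool), Measurable f ∧
        (Measure.infinitePi fun _ => κ).real
          {x | bits L N (φ x 1) ≠ f fun t : F => x t} ≤ δ' ∧
        (Measure.infinitePi fun _ => κ).real
          {x | q (x 1) ≠ g fun s : E => f fun t : F => x (s * t : G)} ≤ δ + δ' := by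
  classical
  set μ := Measure.infinitePi fun _ : G => κ
  set ν := Measure.infinitePi fun _ : G => lam
  obtain ⟨x₀⟩ := nonempty_of_isProbabilityMeasure κ
  have : Nonempty A := ⟨q x₀⟩
  obtain ⟨N, E, g, hg⟩ := exists_bits_approx ν (h := fun y => q (ψ y 1))
    (hq.comp ((measurable_pi_apply 1).comp hψ)) hδ
  -- The decoder is fixed before `δ'`, so `δ'` may later depend on the cost of a wrong symbol, which
  -- grows with `N`.
  refine ⟨N, E, g, fun δ' hδ' => ?_⟩
  have hbφ : Measurable fun x => bits L N (φ x 1) :=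
    (measurable_bits L N).comp ((measurable_pi_apply 1).comp hφ.measurable)
  -- The decoder consults one translate for each `s ∈ E`, so the error budget is shared; the `+ 1`
  -- covers empty `E`.
  have hη : 0 < δ' / (E.card + 1) := by positivity
  obtain ⟨F, f, hf, hle⟩ := exists_local_approx μ hbφ hη
  have hcard : δ' / (E.card + 1) * (E.card + 1) = δ' := by field_simp
  have hE0 : (0 : ℝ) ≤ E.card := by positivity
  refine ⟨F, f, hf, hle.trans (by nlinarith), ?_⟩
  set Bad := {x | bits L N (φ x 1) ≠ f fun t : F => x t}
  have hBadm : MeasurableSet Bad :=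
    (measurableSet_eq_fun hbφ (hf.comp (by fun_prop))).compl
  set Bad' := {y | q (ψ y 1) ≠ g fun s : E => bits L N (y s)}
  have hBad'm : MeasurableSet Bad' := by
    refine (measurableSet_eq_fun (hq.comp ((measurable_pi_apply 1).comp hψ)) ?_).compl
    exact (measurable_of_finite g).comp (measurable_pi_lambda _ fun s =>
      (measurable_bits L N).comp (measurable_pi_apply _))
  have hshift (s : G) : MeasurePreserving (fun (x : G → K) h => x (s * h)) μ μ :=
    measurePreserving_comp_injective κ (mul_right_injective s)
  -- Decoding fails only if `g` errs on the true bits of `φ x`, or if `f` errs at some `s ∈ E`;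
  -- equivariance turns the latter into a translate of `Bad`.
  have hsub : {x | q (x 1) ≠ g fun s : E => f fun t : F => x (s * t)} ≤ᵐ[μ]
      (φ ⁻¹' Bad' ∪ ⋃ s ∈ E, (fun (x : G → K) h => x (s * h)) ⁻¹' Bad : Set (G → K)) := by
    have hequiv' := ae_all_iff.2 hequiv
    filter_upwards [hequiv', hinv] with x hx hxinv hne
    by_contra hnot
    have h1 : ¬ (x ∈ φ ⁻¹' Bad') := fun h => hnot (Or.inl h)
    have h2 : ∀ s ∈ E, ¬ ((fun h => x (s * h)) ∈ Bad) := fun s hs h =>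
      hnot (Or.inr (Set.mem_biUnion hs h))
    have h1' : q (x 1) = g fun s : E => bits L N (φ x s) := by
      by_contra h
      refine h1 ?_
      change q (ψ (φ x) 1) ≠ _
      rwa [hxinv]
    have h2' : ∀ s ∈ E, bits L N (φ x s) = f fun t : F => x (s * t) := by
      intro s hs
      by_contra h
      refine h2 s hs ?_
      change bits L N (φ (fun h => x (s * h)) 1) ≠ _
      rw [hx s]
      simpa using h
    refine hne ?_
    rw [h1']
    congr 1
    exact funext fun s => h2' s s.2
  calc μ.real {x | q (x 1) ≠ g fun s : E => f fun t : F => x (s * t)}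
      ≤ μ.real (φ ⁻¹' Bad' ∪ ⋃ s ∈ E, (fun (x : G → K) h => x (s * h)) ⁻¹' Bad) :=
        ENNReal.toReal_mono (measure_ne_top _ _) (measure_mono_ae hsub)
    _ ≤ μ.real (φ ⁻¹' Bad') +
        ∑ s ∈ E, μ.real ((fun (x : G → K) h => x (s * h)) ⁻¹' Bad) :=
        (measureReal_union_le _ _).trans
          (add_le_add le_rfl (measureReal_biUnion_finset_le _ _))
    _ = ν.real Bad' + ∑ s ∈ E, μ.real Bad := by
        congr 1
        · rw [measureReal_def, hφ.measure_preimage hBad'm.nullMeasurableSet]; rfl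
        · refine Finset.sum_congr rfl fun s _ => ?_
          rw [measureReal_def, (hshift s).measure_preimage hBadm.nullMeasurableSet]; rfl
    _ ≤ δ + ∑ s ∈ E, δ' / (E.card + 1) := by gcongr
    _ ≤ δ + δ' := by
        rw [Finset.sum_const, nsmul_eq_mul]
        nlinarith

/-- Over a sofic group, the base entropy does not exceed that of a Bernoulli shift which generates
an isomorphic system. -/
theorem IsSofic.baseEntropy_le [StandardBorelSpace K] (hG : IsSofic G)
    (hφ : MeasurePreserving φ (Measure.infinitePi fun _ => κ) (Measure.infinitePi fun _ => lam))
    (hequiv : ∀ s : G, ∀ᵐ x ∂(Measure.infinitePi fun _ : G => κ),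
      φ (fun h => x (s * h)) = fun h => φ x (s * h))
    (hψ : Measurable ψ) (hinv : ∀ᵐ x ∂(Measure.infinitePi fun _ : G => κ), ψ (φ x) = x) :
    baseEntropy κ ≤ baseEntropy lam := by
  classical
  refine baseEntropy_le_of_fiberEntropy_bits_le κ _ fun n => ?_
  set q := bits K n
  have hq : Measurable q := measurable_bits K n
  let A := Fin n → Bool
  set μ := Measure.infinitePi fun _ : G => κ
  have key (η : ℝ) (hη : 0 < η) : ∃ N, fiberEntropy κ q ≤ fiberEntropy lam (bits L N) + η := by
    -- `t` is the smoothing weight: mixing with the uniform law keeps `w` and `W` positive, at a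
    -- cost of at most `-log (1 - t) = η / 4` each where the approximations are exact.
    obtain ⟨t, ht0, ht1, htη⟩ : ∃ t : ℝ, 0 < t ∧ t < 1 ∧ -Real.log (1 - t) = η / 4 :=
      ⟨1 - Real.exp (-(η / 4)), by
        have := Real.exp_lt_one_iff.2 (show -(η / 4) < 0 by linarith)
        linarith, by linarith [Real.exp_pos (-(η / 4))], by simp⟩
    have mix {B : Type} [Fintype B] [Nonempty B] : 0 < t / Fintype.card B ∧
        t / Fintype.card B ≤ 1 := by
      have h1 : (1 : ℝ) ≤ Fintype.card B := by exact_mod_cast Fintype.card_pos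
      exact ⟨by positivity, (div_le_one (by linarith)).2 (by linarith)⟩
    set cA : ℝ := -Real.log (t / Fintype.card A)
    have hcA0 : 0 ≤ cA := neg_nonneg.2 (Real.log_nonpos mix.1.le mix.2)
    obtain ⟨N, E, g, hfac⟩ := exists_local_factor κ lam hφ hequiv hψ hinv hq
      (δ := η / (8 * (cA + 1))) (by positivity)
    let B := Fin N → Bool
    set cB : ℝ := -Real.log (t / Fintype.card B)
    have hcB0 : 0 ≤ cB := neg_nonneg.2 (Real.log_nonpos mix.1.le mix.2)
    obtain ⟨F, f, hf, hF1, hF2⟩ := hfac (η / (8 * (cA + cB + 1))) (by positivity)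
    set p : B → ℝ := fun b => lam.real (bits L N ⁻¹' {b}) with hp
    have hp0 (b) : 0 ≤ p b := measureReal_nonneg
    have hp1 : ∑ b, p b = 1 := by
      have := integral_comp_eq_sum lam (measurable_bits L N) fun _ => (1 : ℝ)
      simpa using this.symm
    set w : B → ℝ := fun b => (1 - t) * p b + t / Fintype.card B with hwdef
    have hwle (b) : t / Fintype.card B ≤ w b := by
      have := mul_nonneg (sub_nonneg.2 ht1.le) (hp0 b)
      simp only [hwdef]
      linarith
    have hw (b) : 0 < w b := (mix (B := B)).1.trans_le (hwle b)
    have hw1 : ∑ b, w b = 1 := by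
      simp only [hwdef]
      rw [Finset.sum_add_distrib, ← Finset.mul_sum, hp1, Finset.sum_const, Finset.card_univ,
        nsmul_eq_mul]
      field_simp
      ring
    have hwle1 (b) : w b ≤ 1 :=
      hw1 ▸ Finset.single_le_sum (fun b _ => (hw b).le) (Finset.mem_univ _)
    set W : A → A → ℝ := fun a c => (1 - t) * (if a = c then 1 else 0) + t / Fintype.card A
      with hWdef
    have hWle (a c) : t / Fintype.card A ≤ W a c := by
      have : 0 ≤ (1 - t) * (if a = c then (1 : ℝ) else 0) :=
        mul_nonneg (by linarith) (by split_ifs <;> norm_num)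
      simp only [hWdef]
      linarith
    have hW (a c) : 0 < W a c := (mix (B := A)).1.trans_le (hWle a c)
    have hW1 (c) : ∑ a, W a c = 1 := by
      simp only [hWdef]
      rw [Finset.sum_add_distrib, ← Finset.mul_sum, Finset.sum_const, Finset.card_univ,
        nsmul_eq_mul, Finset.sum_ite_eq' Finset.univ c, if_pos (Finset.mem_univ _),
        mul_div_cancel₀ _ (Nat.cast_ne_zero.2 Fintype.card_ne_zero)]
      ring
    set S₁ := {x : G → K | bits L N (φ x 1) ≠ f fun t : F => x t}
    set S₂ := {x : G → K | q (x 1) ≠ g fun s : E => f fun t : F => x (s * t)}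
    have hbφ : Measurable fun x => bits L N (φ x 1) :=
      (measurable_bits L N).comp ((measurable_pi_apply 1).comp hφ.measurable)
    have hfm : Measurable fun x : G → K => f fun t : F => x t := hf.comp (by fun_prop)
    have hgm : Measurable fun x : G → K => g fun s : E => f fun t : F => x (s * t) :=
      (measurable_of_finite g).comp (measurable_pi_lambda _ fun s => hf.comp (by fun_prop))
    have hqm : Measurable fun x : G → K => q (x 1) := hq.comp (measurable_pi_apply 1)
    have hS₁m : MeasurableSet S₁ := (measurableSet_eq_fun hbφ hfm).compl
    have hS₂m : MeasurableSet S₂ := (measurableSet_eq_fun hqm hgm).compl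
    have hmain := hG.fiberEntropy_le_integral κ E F f g q hf hq w hw hw1 W hW hW1
    have hintw : Integrable (fun x => -Real.log (w (bits L N (φ x 1)))) μ :=
      integrable_comp_finite μ hbφ fun b => -Real.log (w b)
    have hint1 : Integrable (S₁.indicator fun _ => cB) μ :=
      (integrable_const cB).indicator hS₁m
    have hint2 : Integrable (S₂.indicator fun _ => cA) μ :=
      (integrable_const cA).indicator hS₂m
    have hint3 : Integrable (fun x => -Real.log (w (bits L N (φ x 1))) +
        S₁.indicator (fun _ => cB) x) μ := hintw.add hint1
    have hint4 : Integrable (fun x => S₂.indicator (fun _ => cA) x + η / 4) μ :=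
      hint2.add (integrable_const _)
    -- Replacing `f` by the true bits costs at most `cB`, and only on `S₁`; decoding costs at most
    -- `cA` on `S₂` and `η / 4` elsewhere.
    have hpt (x : G → K) : -Real.log (w (f fun t : F => x t)) -
        Real.log (W (q (x 1)) (g fun s : E => f fun t : F => x (s * t))) ≤
        -Real.log (w (bits L N (φ x 1))) + S₁.indicator (fun _ => cB) x +
          (S₂.indicator (fun _ => cA) x + η / 4) := by
      have h1 : -Real.log (w (f fun t : F => x t)) ≤
          -Real.log (w (bits L N (φ x 1))) + S₁.indicator (fun _ => cB) x := by
        by_cases hx : x ∈ S₁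
        · rw [Set.indicator_of_mem hx]
          have h3 := Real.log_nonpos (hw (bits L N (φ x 1))).le (hwle1 _)
          have h4 := Real.log_le_log (mix (B := B)).1 (hwle (f fun t : F => x t))
          linarith
        · rw [Set.indicator_of_notMem hx, add_zero, not_not.1 hx]
      have h2 : -Real.log (W (q (x 1)) (g fun s : E => f fun t : F => x (s * t))) ≤
          S₂.indicator (fun _ => cA) x + η / 4 := by
        by_cases hx : x ∈ S₂
        · rw [Set.indicator_of_mem hx]
          have h4 := Real.log_le_log (mix (B := A)).1
            (hWle (q (x 1)) (g fun s : E => f fun t : F => x (s * t)))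
          linarith
        · rw [Set.indicator_of_notMem hx, zero_add, not_not.1 hx, ← htη]
          refine neg_le_neg (Real.log_le_log (by linarith) ?_)
          simp only [hWdef, if_true, mul_one]
          linarith [(mix (B := A)).1]
      linarith
    have hwint : ∫ x, -Real.log (w (bits L N (φ x 1))) ∂μ ≤
        fiberEntropy lam (bits L N) + η / 4 := by
      have hmp : MeasurePreserving (fun x => φ x 1) μ lam :=
        (measurePreserving_eval_infinitePi (fun _ : G => lam) 1).comp hφ
      have h1 := integral_map hmp.measurable.aemeasurable (μ := μ)
        (f := fun y => -Real.log (w (bits L N y)))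
        ((measurable_of_finite fun b => -Real.log (w b)).comp
          (measurable_bits L N)).aestronglyMeasurable
      rw [hmp.map_eq] at h1
      rw [← h1, ← htη, ← sub_eq_add_neg]
      exact integral_neg_log_mix_le lam (measurable_bits L N) ht0 ht1 (mix (B := B)).1
    refine ⟨N, hmain.trans ?_⟩
    calc _ ≤ ∫ x, (-Real.log (w (bits L N (φ x 1))) + S₁.indicator (fun _ => cB) x +
          (S₂.indicator (fun _ => cA) x + η / 4)) ∂μ := by
          refine integral_mono_of_nonneg (.of_forall fun x => ?_)
            (hint3.add hint4) (.of_forall hpt)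
          have h1 := Real.log_nonpos (hw (f fun t : F => x t)).le (hwle1 _)
          have h2 := Real.log_nonpos (hW (q (x 1)) (g fun s : E => f fun t : F => x (s * t))).le
            (hW1 (g fun s : E => f fun t : F => x (s * t)) ▸ Finset.single_le_sum
              (f := fun a => W a (g fun s : E => f fun t : F => x (s * t)))
              (fun a _ => (hW a _).le) (Finset.mem_univ _))
          change (0 : ℝ) ≤ _
          linarith
      _ = ∫ x, -Real.log (w (bits L N (φ x 1))) ∂μ + μ.real S₁ * cB +
          (μ.real S₂ * cA + η / 4) := by
          rw [integral_add hint3 hint4,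
            integral_add hintw hint1, integral_add hint2 (integrable_const _),
            integral_indicator_const _ hS₁m, integral_indicator_const _ hS₂m]
          simp
      _ ≤ fiberEntropy lam (bits L N) + η := by
          -- The two error sets cost at most `η / 8 + η / 8`, and the two smoothings `η / 4` each.
          have h1 : η / (8 * (cA + 1)) * cA ≤ η / 8 := by
            rw [div_mul_eq_mul_div, div_le_div_iff₀ (by positivity) (by norm_num)]
            nlinarith
          have h2 : η / (8 * (cA + cB + 1)) * (cA + cB) ≤ η / 8 := by
            rw [div_mul_eq_mul_div, div_le_div_iff₀ (by positivity) (by norm_num)]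
            nlinarith
          have h3 := mul_le_mul_of_nonneg_right hF1 hcB0
          have h4 := mul_le_mul_of_nonneg_right hF2 hcA0
          linarith
  refine ENNReal.le_of_forall_pos_le_add fun ε hε _ => ?_
  obtain ⟨N, hN⟩ := key ε hε
  calc ENNReal.ofReal (fiberEntropy κ q)
      ≤ ENNReal.ofReal (fiberEntropy lam (bits L N) + ε) := ENNReal.ofReal_le_ofReal hN
    _ ≤ ENNReal.ofReal (fiberEntropy lam (bits L N)) + ENNReal.ofReal ε := ENNReal.ofReal_add_le
    _ ≤ baseEntropy lam + ε := by
        rw [ENNReal.ofReal_coe_nnreal]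
        gcongr
        exact ofReal_fiberEntropy_le_baseEntropy lam (measurable_bits L N)

end Monotone

/-! ### Conjugacies -/

section Conjugacy

variable {G₁ G₂ X₁ X₂ : Type*} [Group G₁] [Group G₂] [MulAction G₁ X₁] [MulAction G₂ X₂]
  [MeasurableSpace X₁] [MeasurableSpace X₂] {Φ : G₁ ≃* G₂} {μ₁ : Measure X₁} {μ₂ : Measure X₂}

/-- Only the first conull set is required to be invariant; invariance of the second follows because
`φ` is onto it and `Φ` is onto `G₂`. -/
lemma ConjugateAlong.symm (h : ConjugateAlong Φ μ₁ μ₂) : ConjugateAlong Φ.symm μ₂ μ₁ := by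
  obtain ⟨S₁, S₂, φ, hS₁, hS₂, h₁, h₂, hφ, hequiv⟩ := h
  refine ⟨S₂, S₁, φ.symm, hS₂, hS₁, h₂, h₁, hφ.symm, fun g y => ?_⟩
  obtain ⟨hx, hgx⟩ := hequiv (Φ.symm g) (φ.symm y)
  rw [Φ.apply_symm_apply, φ.apply_symm_apply] at hgx
  refine ⟨hgx ▸ Subtype.coe_prop _, ?_⟩
  have : (⟨g • (y : X₂), hgx ▸ Subtype.coe_prop _⟩ : S₂) =
      φ ⟨Φ.symm g • (φ.symm y : X₁), hx⟩ := Subtype.ext hgx.symm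
  rw [this, φ.symm_apply_apply]

/-- A conjugacy extends to a globally defined measurable map with an almost everywhere inverse. -/
lemma ConjugateAlong.exists_measurePreserving (h : ConjugateAlong Φ μ₁ μ₂) [Nonempty X₁]
    [Nonempty X₂] :
    ∃ (φ : X₁ → X₂) (ψ : X₂ → X₁), MeasurePreserving φ μ₁ μ₂ ∧ Measurable ψ ∧
      ∀ᵐ x ∂μ₁, ψ (φ x) = x ∧ ∀ g : G₁, φ (g • x) = Φ g • φ x := by
  obtain ⟨S₁, S₂, φ, hS₁, hS₂, h₁, h₂, hφ, hequiv⟩ := h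
  -- The values of the extensions off the conull sets are immaterial.
  obtain ⟨φ', hφ', hφφ'⟩ := (MeasurableEmbedding.subtype_coe hS₁).exists_measurable_extend
    (measurable_subtype_coe.comp φ.measurable) fun _ => inferInstance
  obtain ⟨ψ', hψ', hψψ'⟩ := (MeasurableEmbedding.subtype_coe hS₂).exists_measurable_extend
    (measurable_subtype_coe.comp φ.symm.measurable) fun _ => inferInstance
  have e₁ : (μ₁.comap Subtype.val).map (Subtype.val : S₁ → X₁) = μ₁ := by
    rw [map_comap_subtype_coe hS₁, Measure.restrict_eq_self_of_ae_mem (mem_ae_iff.2 h₁)]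
  have e₂ : (μ₂.comap Subtype.val).map (Subtype.val : S₂ → X₂) = μ₂ := by
    rw [map_comap_subtype_coe hS₂, Measure.restrict_eq_self_of_ae_mem (mem_ae_iff.2 h₂)]
  refine ⟨φ', ψ', ⟨hφ', ?_⟩, hψ', ?_⟩
  · rw [← e₁, Measure.map_map hφ' measurable_subtype_coe, hφφ',
      ← Measure.map_map measurable_subtype_coe φ.measurable, hφ.map_eq, e₂]
  · have hval (x : S₁) : φ' x = φ x := congrFun hφφ' x
    filter_upwards [mem_ae_iff.2 h₁] with x hx
    refine ⟨?_, fun g => ?_⟩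
    · rw [hval ⟨x, hx⟩]
      have := congrFun hψψ' (φ ⟨x, hx⟩)
      simpa using this
    · obtain ⟨hgx, h⟩ := hequiv g ⟨x, hx⟩
      rw [hval ⟨x, hx⟩, ← h, ← hval]

/-- The restriction of a measurable equivalence to the preimage of a set. -/
def restrictPreimageEquiv {X Y : Type*} [MeasurableSpace X] [MeasurableSpace Y] (e : X ≃ᵐ Y)
    (s : Set Y) : (e ⁻¹' s) ≃ᵐ s where
  toFun x := ⟨e x, x.2⟩
  invFun y := ⟨e.symm y, by simp⟩
  left_inv x := by simp
  right_inv y := by simp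
  measurable_toFun := (e.measurable.comp measurable_subtype_coe).subtype_mk
  measurable_invFun := (e.symm.measurable.comp measurable_subtype_coe).subtype_mk

lemma measurePreserving_restrictPreimageEquiv {X Y : Type*} [MeasurableSpace X]
    [MeasurableSpace Y] {e : X ≃ᵐ Y} {μ : Measure X} {ν : Measure Y} (he : MeasurePreserving e μ ν)
    {s : Set Y} (hs : MeasurableSet s) :
    MeasurePreserving (restrictPreimageEquiv e s) (μ.comap Subtype.val)
      (ν.comap Subtype.val) := by
  refine ⟨(restrictPreimageEquiv e s).measurable, Measure.ext fun t ht => ?_⟩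
  rw [Measure.map_apply (restrictPreimageEquiv e s).measurable ht,
    comap_subtype_coe_apply (e.measurable hs), comap_subtype_coe_apply hs,
    ← he.measure_preimage (hs.subtype_image ht).nullMeasurableSet]
  congr 1
  ext x
  simp [restrictPreimageEquiv]

/-- Conjugacies are transported along isomorphisms of the two systems. -/
lemma ConjugateAlong.of_measurableEquiv {Y₁ Y₂ : Type*} [MulAction G₁ Y₁] [MulAction G₂ Y₂]
    [MeasurableSpace Y₁] [MeasurableSpace Y₂] {ν₁ : Measure Y₁} {ν₂ : Measure Y₂}
    (h : ConjugateAlong Φ ν₁ ν₂) (e₁ : X₁ ≃ᵐ Y₁) (e₂ : X₂ ≃ᵐ Y₂)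
    (he₁ : MeasurePreserving e₁ μ₁ ν₁) (he₂ : MeasurePreserving e₂ μ₂ ν₂)
    (hg₁ : ∀ (g : G₁) x, e₁ (g • x) = g • e₁ x) (hg₂ : ∀ (g : G₂) x, e₂ (g • x) = g • e₂ x) :
    ConjugateAlong Φ μ₁ μ₂ := by
  obtain ⟨S₁, S₂, φ, hS₁, hS₂, h₁, h₂, hφ, hequiv⟩ := h
  have m₁ := measurePreserving_restrictPreimageEquiv he₁ hS₁
  have m₂ := measurePreserving_restrictPreimageEquiv he₂ hS₂
  refine ⟨e₁ ⁻¹' S₁, e₂ ⁻¹' S₂,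
    ((restrictPreimageEquiv e₁ S₁).trans φ).trans (restrictPreimageEquiv e₂ S₂).symm,
    e₁.measurable hS₁, e₂.measurable hS₂, ?_, ?_,
    (MeasurePreserving.symm _ m₂).comp (hφ.comp m₁), fun g x => ?_⟩
  · rw [← Set.preimage_compl, he₁.measure_preimage hS₁.compl.nullMeasurableSet, h₁]
  · rw [← Set.preimage_compl, he₂.measure_preimage hS₂.compl.nullMeasurableSet, h₂]
  · obtain ⟨hgx, h⟩ := hequiv g ⟨e₁ x, x.2⟩
    have hmem : g • (x : X₁) ∈ e₁ ⁻¹' S₁ := by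
      rw [Set.mem_preimage, hg₁]
      exact hgx
    refine ⟨hmem, e₂.injective ?_⟩
    have key (z : e₁ ⁻¹' S₁) : e₂ ((((restrictPreimageEquiv e₁ S₁).trans φ).trans
        (restrictPreimageEquiv e₂ S₂).symm z : e₂ ⁻¹' S₂) : X₂) = φ ⟨e₁ z, z.2⟩ :=
      e₂.apply_symm_apply _
    rw [key, hg₂, key, ← h]
    congr 2
    exact Subtype.ext (hg₁ g x)

end Conjugacy

/-! ### Bernoulli shifts -/

lemma bernoulli_smul_apply {G K : Type*} [Group G] (g : G) (x : BernoulliSpace G K) (h : G) :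
    (g • x) h = x (g⁻¹ * h) := rfl

/-- The base entropy is monotone under conjugacies of Bernoulli shifts over sofic groups. -/
lemma IsSofic.baseEntropy_le_of_conjugateAlong {G K L : Type*} [Group G] [Countable G]
    [MeasurableSpace K] [StandardBorelSpace K] [MeasurableSpace L] [StandardBorelSpace L]
    (κ : Measure K) [IsProbabilityMeasure κ] (lam : Measure L) [IsProbabilityMeasure lam]
    (hG : IsSofic G) {Φ : G ≃* G}
    (h : ConjugateAlong Φ (bernoulliMeasure G κ) (bernoulliMeasure G lam)) :
    baseEntropy κ ≤ baseEntropy lam := by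
  have hK : Nonempty (BernoulliSpace G K) :=
    (nonempty_of_isProbabilityMeasure κ).map fun k _ => k
  have hL : Nonempty (BernoulliSpace G L) :=
    (nonempty_of_isProbabilityMeasure lam).map fun l _ => l
  obtain ⟨φ, ψ, hφ, hψ, hae⟩ := h.exists_measurePreserving
  -- Reindexing `L^G` by `Φ` preserves the product measure and turns equivariance along `Φ` into
  -- plain equivariance.
  refine hG.baseEntropy_le κ lam (φ := fun x h => φ x (Φ h))
    (ψ := fun y => ψ fun h => y (Φ.symm h))
    ((measurePreserving_comp_injective lam Φ.injective).comp hφ) (fun s => ?_)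
    (hψ.comp (measurable_pi_lambda _ fun h => measurable_pi_apply (Φ.symm h))) ?_
  · have h2 (x : BernoulliSpace G K) : s⁻¹ • x = fun h => x (s * h) := by
      funext h
      rw [bernoulli_smul_apply, inv_inv]
    filter_upwards [hae] with x hx
    have h1 := hx.2 s⁻¹
    rw [h2 x] at h1
    funext h
    rw [h1, bernoulli_smul_apply, map_inv, inv_inv, map_mul]
  · filter_upwards [hae] with x hx
    have : (fun h => φ x (Φ (Φ.symm h))) = φ x := by simp
    rw [this]
    exact hx.1

/-- Replacing the base spaces by isomorphic ones does not change the Bernoulli shifts. -/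
lemma isomorphic_bernoulli_of_map {G K₁ K₂ L₁ L₂ : Type*} [Group G] [MeasurableSpace K₁]
    [MeasurableSpace K₂] [MeasurableSpace L₁] [MeasurableSpace L₂] (κ₁ : Measure K₁)
    [IsProbabilityMeasure κ₁] (κ₂ : Measure K₂) [IsProbabilityMeasure κ₂] (e₁ : K₁ ≃ᵐ L₁)
    (e₂ : K₂ ≃ᵐ L₂)
    (h : Isomorphic G (bernoulliMeasure G (κ₁.map e₁)) (bernoulliMeasure G (κ₂.map e₂))) :
    Isomorphic G (bernoulliMeasure G κ₁) (bernoulliMeasure G κ₂) :=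
  ConjugateAlong.of_measurableEquiv h (MeasurableEquiv.piCongrRight fun _ => e₁)
    (MeasurableEquiv.piCongrRight fun _ => e₂)
    ⟨MeasurableEquiv.measurable _, Measure.infinitePi_map_pi _ fun _ => e₁.measurable⟩
    ⟨MeasurableEquiv.measurable _, Measure.infinitePi_map_pi _ fun _ => e₂.measurable⟩
    (fun _ _ => rfl) fun _ _ => rfl

/-- A standard Borel space is isomorphic to one in the lowest universe. -/
lemma exists_measurableEquiv_real_subset (K : Type*) [MeasurableSpace K] [StandardBorelSpace K] :
    ∃ s : Set ℝ, MeasurableSet s ∧ Nonempty (K ≃ᵐ s) :=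
  have h := measurableEmbedding_embeddingReal K
  ⟨_, h.measurableSet_range, ⟨h.equivRange⟩⟩

/-- Over an Ornstein group, Bernoulli shifts of equal base entropy are isomorphic, with base spaces
in arbitrary universes. -/
lemma IsOrnstein.isomorphic {G K₁ K₂ : Type*} [Group G] (hG : IsOrnstein G)
    [MeasurableSpace K₁] [StandardBorelSpace K₁] [MeasurableSpace K₂] [StandardBorelSpace K₂]
    (κ₁ : Measure K₁) [IsProbabilityMeasure κ₁] (κ₂ : Measure K₂) [IsProbabilityMeasure κ₂]
    (h : baseEntropy κ₁ = baseEntropy κ₂) :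
    Isomorphic G (bernoulliMeasure G κ₁) (bernoulliMeasure G κ₂) := by
  -- `IsOrnstein` speaks only of base spaces in `Type`, so both bases are first moved to Borel
  -- subsets of `ℝ`.
  obtain ⟨s₁, hs₁, ⟨e₁⟩⟩ := exists_measurableEquiv_real_subset K₁
  obtain ⟨s₂, hs₂, ⟨e₂⟩⟩ := exists_measurableEquiv_real_subset K₂
  have := hs₁.standardBorel
  have := hs₂.standardBorel
  have := Measure.isProbabilityMeasure_map (μ := κ₁) e₁.measurable.aemeasurable
  have := Measure.isProbabilityMeasure_map (μ := κ₂) e₂.measurable.aemeasurable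
  refine isomorphic_bernoulli_of_map κ₁ κ₂ e₁ e₂ (hG _ _ _ _ ?_)
  rw [baseEntropy_map_measurableEquiv, baseEntropy_map_measurableEquiv, h]

end SoficBernoulli

theorem mainTheorem7 {G : Type*} [Group G] [Countable G]
    (hsofic : SoficBernoulli.IsSofic G) (hornstein : SoficBernoulli.IsOrnstein G)
    {K₁ K₂ : Type*} [MeasurableSpace K₁] [StandardBorelSpace K₁]
    [MeasurableSpace K₂] [StandardBorelSpace K₂]
    (κ₁ : MeasureTheory.Measure K₁) [MeasureTheory.IsProbabilityMeasure κ₁]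
    (κ₂ : MeasureTheory.Measure K₂) [MeasureTheory.IsProbabilityMeasure κ₂] :
    SoficBernoulli.ConjugateUpToAutomorphisms G G
        (SoficBernoulli.bernoulliMeasure G κ₁) (SoficBernoulli.bernoulliMeasure G κ₂) ↔
      SoficBernoulli.baseEntropy κ₁ = SoficBernoulli.baseEntropy κ₂ := by
  refine ⟨fun ⟨Φ, h⟩ => ?_, fun h => ⟨MulEquiv.refl G, hornstein.isomorphic κ₁ κ₂ h⟩⟩
  exact le_antisymm (hsofic.baseEntropy_le_of_conjugateAlong κ₁ κ₂ h)
    (hsofic.baseEntropy_le_of_conjugateAlong κ₂ κ₁ h.symm)
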